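/- Consider a call centre with $k$ agents and $\ell\ge k$ telephone lines. Calls arrive at rate $\lambda>0$, each busy agent serves at rate $\mu>0$, and each waiting caller abandons at rate $\theta>0$. The number of callers in the system is a continuous-time Markov chain on $\{0,1,\dots,\ell\}$. In state $a$ the following events occur: an arrival at rate $\lambda$ (to $a+1$ if $a<\ell$; if $a=\ell$ the call is blocked and the state does not change), a service completion at rate $\min(a,k)\mu$ (to $a-1$), and an abandonment at rate $\max(0,a-k)\theta$ (to $a-1$). Let $\beta,\gamma\in\mathbb R$ be the costs of a blocked call and of an abandonment. For $t>0$ and initial state $a$ let $A_a(t)$ be the expected total cost of abandonments and blocked calls during $(0,t)$, let $W_a(t)$ be the expected total time that all callers together spend waiting during $(0,t)$ (that is, the expectation of $\int_0^t\max(0,X_u-k)\,du$, where $X_u$ is the state at time $u$), and let $S_a(t)$ be the expected number of services completed during $(0,t)$. Write $\tilde f(s)=\int_0^\infty e^{-st}f(t)\,dt$ for the Laplace transform, and put $\tilde A_a=\tilde W_a=\tilde S_a=0$ for $a\notin\{0,\dots,\ell\}$. Almost surely only finitely many events occur in bounded time, the three expectations exist and are finite, and their Laplace transforms converge absolutely for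 all $s\in\mathbb C$ with $\operatorname{Re}s>0$. For all such $s$ and all $a\in\{0,\dots,\ell\}$, with $$r_a=\lambda\mathbf 1_{a<\ell}+\min(a,k)\mu+\max(0,a-k)\theta,\qquad d_a=\min(a,k)\mu+\max(0,a-k)\theta,$$ one has $$\tilde A_a(s)=\frac{\lambda\tilde A_{a+1}(s)\mathbf 1_{a<\ell}+d_a\tilde A_{a-1}(s)+\frac{1}{s}\bigl(\max(0,a-k)\theta\gamma+\lambda\beta\mathbf 1_{a=\ell}\bigr)}{r_a+s},$$ $$\tilde W_a(s)=\frac{\lambda\tilde W_{a+1}(s)\mathbf 1_{a<\ell}+d_a\tilde W_{a-1}(s)+\frac{1}{s}\max(0,a-k)}{r_a+s},$$ $$\tilde S_a(s)=\frac{\lambda\tilde S_{a+1}(s)\mathbf 1_{a<\ell}+d_a\tilde S_{a-1}(s)+\frac{1}{s}\min(a,k)\mu}{r_a+s}.$$ If $\beta=0$, the abandonment cost and the waiting time are proportional: $A_a(t)=\theta\gamma\,W_a(t)$ for all $a\in\{0,\dots,\ell\}$ and $t>0$, and $\tilde A_a(s)=\theta\gamma\,\tilde W_a(s)$ for all integers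 $a$ and all $s$ with $\operatorname{Re}s>0$. -/

import Mathlib

open MeasureTheory ProbabilityTheory

noncomputable section

/-- Parameters of a single-skill call centre: `k` agents, `ℓ ≥ k` telephone lines, arrival rate
`lam`, service rate `mu` of a busy agent, abandonment rate `theta` of a waiting caller. -/
structure CallCentre where
  k : ℕ
  ℓ : ℕ
  k_le : k ≤ ℓ
  lam : ℝ
  mu : ℝ
  theta : ℝ
  lam_pos : 0 < lam
  mu_pos : 0 < mu
  theta_pos : 0 < theta

/-- The events that can happen: a call arrives, a service ends, a waiting caller abandons. -/
inductive CallEvent where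
  | arrival
  | service
  | abandonment
  deriving DecidableEq

instance : Fintype CallEvent where
  elems := {.arrival, .service, .abandonment}
  complete := by intro e; cases e <;> decide

instance : MeasurableSpace CallEvent := ⊤

namespace CallCentre

variable (C : CallCentre)

/-- The state space `{0, 1, …, ℓ}`: the number of callers in the system. -/
abbrev State : Type := Fin (C.ℓ + 1)

/-- The number of callers being served in state `a`. -/
def busy (a : C.State) : ℝ := min ((a : ℕ) : ℝ) (C.k : ℝ)

/-- The number of callers waiting in state `a`. -/
def waiting (a : C.State) : ℝ := max 0 (((a : ℕ) : ℝ) - (C.k : ℝ))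

/-- The rate at which each event occurs in state `a`. -/
def rate (a : C.State) : CallEvent → ℝ
  | .arrival => C.lam
  | .service => C.busy a * C.mu
  | .abandonment => C.waiting a * C.theta

/-- The state after an event. An arrival in state `ℓ` is blocked and leaves the state unchanged. -/
def next (a : C.State) : CallEvent → C.State
  | .arrival => if h : (a : ℕ) < C.ℓ then ⟨(a : ℕ) + 1, Nat.succ_lt_succ h⟩ else a
  | .service => ⟨(a : ℕ) - 1, lt_of_le_of_lt (Nat.sub_le _ _) a.isLt⟩
  | .abandonment => ⟨(a : ℕ) - 1, lt_of_le_of_lt (Nat.sub_le _ _) a.isLt⟩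

/-- The total rate of events (blocked arrivals included) in state `a`. -/
def totalRate (a : C.State) : ℝ := ∑ e, C.rate a e

theorem rate_nonneg (a : C.State) (e : CallEvent) : 0 ≤ C.rate a e := by
  cases e
  · exact C.lam_pos.le
  · exact mul_nonneg (le_min (Nat.cast_nonneg _) (Nat.cast_nonneg _)) C.mu_pos.le
  · exact mul_nonneg (le_max_left _ _) C.theta_pos.le

theorem totalRate_pos (a : C.State) : 0 < C.totalRate a :=
  lt_of_lt_of_le C.lam_pos
    (Finset.single_le_sum (f := C.rate a) (fun e _ => C.rate_nonneg a e)
      (Finset.mem_univ CallEvent.arrival))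

/-- In state `a`, the next event is `e` with probability `rate a e / totalRate a`. -/
def eventPMF (a : C.State) : PMF CallEvent :=
  PMF.ofFintype (fun e => ENNReal.ofReal (C.rate a e / C.totalRate a)) (by
    rw [← ENNReal.ofReal_sum_of_nonneg
      (fun e _ => div_nonneg (C.rate_nonneg a e) (C.totalRate_pos a).le), ← Finset.sum_div]
    change ENNReal.ofReal (C.totalRate a / C.totalRate a) = 1
    rw [div_self (C.totalRate_pos a).ne', ENNReal.ofReal_one])

/-- The joint law, in state `a`, of the time until the next event and of that event: the time is
exponential with rate `totalRate a` and independent of the event. -/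
def stepLaw (a : C.State) : Measure (ℝ × CallEvent) :=
  (expMeasure (C.totalRate a)).prod (C.eventPMF a).toMeasure

instance (a : C.State) : IsProbabilityMeasure (C.stepLaw a) := by
  have := isProbabilityMeasure_expMeasure (C.totalRate_pos a)
  unfold stepLaw
  infer_instance

/-- Sample space: `ω n x` is the pair (holding time, event) that is used in the `n`-th step of the
chain if the chain is then in state `x`. -/
abbrev Sample : Type := ℕ → C.State → ℝ × CallEvent

/-- All the pairs `ω n x` are independent, and `ω n x` has law `stepLaw x`. Hence, conditionally on
the first `n` steps, the `n`-th holding time and event have law `stepLaw x`, with `x` the current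
state: this is the jump chain and holding time construction of the continuous-time Markov chain. -/
def prob : Measure C.Sample :=
  Measure.infinitePi (fun _ : ℕ => Measure.pi (fun x : C.State => C.stepLaw x))

variable {C}

/-- The state just before the `n`-th event (`n = 0, 1, …`), when the chain starts in state `a`. -/
def chain (a : C.State) (ω : C.Sample) : ℕ → C.State
  | 0 => a
  | n + 1 => C.next (chain a ω n) (ω n (chain a ω n)).2

/-- The `n`-th event. -/
def event (a : C.State) (ω : C.Sample) (n : ℕ) : CallEvent := (ω n (chain a ω n)).2

/-- The time of the `n`-th event. -/
def eventTime (a : C.State) (ω : C.Sample) (n : ℕ) : ℝ :=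
  ∑ i ∈ Finset.range (n + 1), (ω i (chain a ω i)).1

/-- The state at time `u`, the state after all the events that happen up to time `u`. -/
def stateAt (a : C.State) (ω : C.Sample) (u : ℝ) : C.State :=
  chain a ω (Set.ncard {n : ℕ | eventTime a ω n ≤ u})

open Classical in
/-- The sum of `c x e` over all the events `e` that happen during `(0, t)`, where `x` is the state
just before the event. -/
def eventSum (c : C.State → CallEvent → ℝ) (a : C.State) (t : ℝ) (ω : C.Sample) : ℝ :=
  ∑' n : ℕ, if eventTime a ω n ∈ Set.Ioo 0 t then c (chain a ω n) (event a ω n) else 0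

/-- Cost of an event: `γ` for an abandonment, `β` for an arrival that finds all lines busy. -/
def eventCost (β γ : ℝ) (x : C.State) : CallEvent → ℝ
  | .arrival => if (x : ℕ) = C.ℓ then β else 0
  | .service => 0
  | .abandonment => γ

/-- `1` for a service, `0` for every other event. -/
def serviceCount (_ : C.State) : CallEvent → ℝ
  | .arrival => 0
  | .service => 1
  | .abandonment => 0

/-- The cost of abandonments and losses during `(0, t)`. -/
def cost (β γ : ℝ) (a : C.State) (t : ℝ) (ω : C.Sample) : ℝ := eventSum (eventCost β γ) a t ω

/-- The number of services during `(0, t)`. -/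
def services (a : C.State) (t : ℝ) (ω : C.Sample) : ℝ := eventSum serviceCount a t ω

/-- The total time that all the callers together spend waiting during `(0, t)`. -/
def waitingTime (a : C.State) (t : ℝ) (ω : C.Sample) : ℝ :=
  ∫ u in Set.Ioo 0 t, C.waiting (stateAt a ω u)

/-- `A_a(t)`: the expected cost of abandonments and losses during `(0, t)` from state `a`. -/
def A (β γ : ℝ) (a : C.State) (t : ℝ) : ℝ := ∫ ω, cost β γ a t ω ∂C.prob

/-- `W_a(t)`: the expected total waiting time during `(0, t)` from state `a`. -/
def W (a : C.State) (t : ℝ) : ℝ := ∫ ω, waitingTime a t ω ∂C.prob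

/-- `S_a(t)`: the expected number of services during `(0, t)` from state `a`. -/
def S (a : C.State) (t : ℝ) : ℝ := ∫ ω, services a t ω ∂C.prob

/-- Convergence of the integral that defines the Laplace transform of `f` at `s`. -/
def LaplaceConverges (f : ℝ → ℝ) (s : ℂ) : Prop :=
  IntegrableOn (fun t : ℝ => Complex.exp (-(s * (t : ℂ))) * ((f t : ℝ) : ℂ)) (Set.Ioi 0)

/-- The Laplace transform `∫_0^∞ e^{-st} f(t) dt`. -/
def laplace (f : ℝ → ℝ) (s : ℂ) : ℂ :=
  ∫ t in Set.Ioi (0 : ℝ), Complex.exp (-(s * (t : ℂ))) * ((f t : ℝ) : ℂ)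

/-- The Laplace transform of `f a`, set to `0` for `a ∉ {0, 1, …, ℓ}`. -/
def laplaceExt (f : C.State → ℝ → ℝ) (a : ℤ) (s : ℂ) : ℂ :=
  if h : 0 ≤ a ∧ a ≤ (C.ℓ : ℤ) then laplace (f ⟨a.toNat, by omega⟩) s else 0

end CallCentre

end

/-! Each of the three quantities is a sum over the steps of the jump chain of a reward that depends
on the current state, the holding time, the event ending it and the time left before the horizon
(`IsReward`). An event reward pays if the holding time fits into the time left. The waiting reward
pays the number of waiting callers times the truncated holding time.

The first holding time and event are independent of the rest, and the rest is a copy of the whole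
sample (`measurePreserving_firstStep`). This gives the renewal equation `meanTotal_eq`: the total
from `a` is the mean first reward plus the mean total from the next state with the remaining time.
Under the Laplace transform the exponential holding time of rate `r` becomes the factor `r / (r +
s)`, and the first reward, whose mean is `G / r * (1 - exp (-r t))`, becomes `G / (s (r + s))`.
Multiplying by `r + s` yields the linear system (`laplace_meanTotal`). A blocked arrival is a jump
from `ℓ` to itself, and its term cancels.

Analytically everything rests on `IsReward.exists_lintegral_reward_le`: the `n`-th reward has mean
absolute value at most `K ρ^n exp (ε t)` with `ρ < 1`, for any `ε > 0`. Hence the sums are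
integrable, the chain does not explode, and the transforms converge on `Re s > 0`.

For `β = 0` the mean abandonment cost of a single step is `θ γ` times its mean waiting time, and the
first-step recursion carries this factor to every step (`meanTotal_proportional`). -/

noncomputable section

/-! ### Splitting off the first term of an i.i.d. sequence -/

section ProductMeasure

variable {X : Type*} [MeasurableSpace X]

theorem measurable_natCases :
    Measurable (fun p : X × (ℕ → X) => (fun n => Nat.casesOn n p.1 p.2 : ℕ → X)) := by
  refine measurable_pi_lambda _ fun n => ?_
  cases n with
  | zero => exact measurable_fst
  | succ n => exact (measurable_pi_apply n).comp measurable_snd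

/-- Prepending an independent coordinate to an i.i.d. sequence gives an i.i.d. sequence. -/
theorem map_natCases_prod_infinitePi (ν : Measure X) [IsProbabilityMeasure ν] :
    (ν.prod (Measure.infinitePi fun _ : ℕ => ν)).map
      (fun p : X × (ℕ → X) => (fun n => Nat.casesOn n p.1 p.2 : ℕ → X)) =
      Measure.infinitePi fun _ : ℕ => ν := by
  classical
  refine Measure.eq_infinitePi _ fun s t ht => ?_
  obtain ⟨N, hN⟩ := s.exists_nat_subset_range
  -- Padding with the whole space turns the cylinder over `s` into one over an initial segment,
  -- which splits into index 0 and shifted indices.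
  set u : ℕ → Set X := fun i => if i ∈ s then t i else Set.univ with hu
  have hum : ∀ i, MeasurableSet (u i) := fun i => by
    by_cases h : i ∈ s <;> simp [hu, h, ht]
  have hsu : Set.pi (s : Set ℕ) t = Set.pi (Finset.range (N + 1) : Set ℕ) u := by
    ext x
    simp only [Set.mem_pi, Finset.mem_coe]
    constructor
    · intro h i _
      by_cases hi : i ∈ s <;> simp [hu, hi, h]
    · intro h i hi
      have := h i (Finset.range_mono (Nat.le_succ N) (hN hi))
      simpa [hu, hi] using this
  have hprod : ∏ i ∈ s, ν (t i) = ∏ i ∈ Finset.range (N + 1), ν (u i) := by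
    rw [← Finset.prod_subset (hN.trans (Finset.range_mono (Nat.le_succ N)))]
    · exact Finset.prod_congr rfl fun i hi => by simp [hu, hi]
    · intro i _ hi
      simp [hu, hi]
  have hpre : (fun p : X × (ℕ → X) => (fun n => Nat.casesOn n p.1 p.2 : ℕ → X)) ⁻¹'
      (Set.pi (Finset.range (N + 1) : Set ℕ) u) =
      u 0 ×ˢ Set.pi (Finset.range N : Set ℕ) (fun i => u (i + 1)) := by
    ext p
    simp only [Set.mem_preimage, Set.mem_pi, Finset.mem_coe, Finset.mem_range, Set.mem_prod]
    constructor
    · intro h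
      exact ⟨h 0 (Nat.succ_pos _), fun i hi => h (i + 1) (Nat.succ_lt_succ hi)⟩
    · rintro ⟨h0, h⟩ i hi
      cases i with
      | zero => exact h0
      | succ i => exact h i (Nat.lt_of_succ_lt_succ hi)
  rw [hsu, hprod, Measure.map_apply measurable_natCases
    (MeasurableSet.pi (Finset.countable_toSet _) fun i _ => hum i), hpre, Measure.prod_prod,
    Measure.infinitePi_pi _ (fun i _ => hum (i + 1)), Finset.prod_range_succ', mul_comm]

/-- The first coordinate of an i.i.d. sequence is independent of the shifted sequence, which has
the law of the sequence. -/
theorem measurePreserving_head_tail (ν : Measure X) [IsProbabilityMeasure ν] :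
    MeasurePreserving (fun ω : ℕ → X => (ω 0, fun n => ω (n + 1)))
      (Measure.infinitePi fun _ : ℕ => ν) (ν.prod (Measure.infinitePi fun _ : ℕ => ν)) := by
  have hm : Measurable (fun ω : ℕ → X => (ω 0, fun n => ω (n + 1))) := by fun_prop
  refine ⟨hm, ?_⟩
  -- Written as the law of a prepended sequence, the measure is undone by the head-tail map: the
  -- composite is the identity.
  conv_lhs => rw [← map_natCases_prod_infinitePi ν]
  rw [Measure.map_map hm measurable_natCases]
  exact Measure.map_id

end ProductMeasure

/-! ### Integrals against the exponential distribution -/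

section Exponential

variable {E : Type*} [NormedAddCommGroup E] [NormedSpace ℝ E]

theorem expMeasure_eq_withDensity (r : ℝ) :
    expMeasure r = (volume.restrict (Set.Ioi 0)).withDensity
      (fun x => ENNReal.ofReal (r * Real.exp (-(r * x)))) := by
  have h : expMeasure r = volume.withDensity (exponentialPDF r) := rfl
  rw [h, Measure.restrict_congr_set (Ioi_ae_eq_Ici (a := (0 : ℝ))),
    ← withDensity_indicator measurableSet_Ici]
  congr 1
  ext x
  rw [exponentialPDF_eq]
  by_cases hx : 0 ≤ x <;> simp [hx]

theorem ae_pos_expMeasure (r : ℝ) : ∀ᵐ x ∂expMeasure r, 0 < x := by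
  rw [expMeasure_eq_withDensity]
  exact (withDensity_absolutelyContinuous _ _).ae_le (ae_restrict_mem measurableSet_Ioi)

theorem integral_expMeasure {r : ℝ} (hr : 0 < r) (f : ℝ → E) :
    ∫ x, f x ∂expMeasure r = ∫ x in Set.Ioi 0, (r * Real.exp (-(r * x))) • f x := by
  rw [expMeasure_eq_withDensity, integral_withDensity_eq_integral_toReal_smul (by fun_prop)
    (by simp)]
  refine integral_congr_ae (Filter.Eventually.of_forall fun x => ?_)
  simp only
  rw [ENNReal.toReal_ofReal (by positivity)]

/-- The Laplace transform of the exponential distribution. -/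
theorem integral_cexp_expMeasure {r : ℝ} (hr : 0 < r) {s : ℂ} (hs : 0 < s.re) :
    ∫ x, Complex.exp (-(s * (x : ℂ))) ∂expMeasure r = r / (r + s) := by
  rw [integral_expMeasure hr]
  have h : ∀ x : ℝ, (r * Real.exp (-(r * x))) • Complex.exp (-(s * (x : ℂ))) =
      r * Complex.exp (-(r + s) * x) := by
    intro x
    rw [Complex.real_smul]
    push_cast
    rw [mul_assoc, ← Complex.exp_add]
    ring_nf
  simp_rw [h]
  rw [integral_const_mul, integral_exp_mul_complex_Ioi (by simp; linarith)]
  simp only [Complex.ofReal_zero, mul_zero, Complex.exp_zero, neg_div_neg_eq, mul_one_div]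

theorem lintegral_exp_expMeasure {r ε : ℝ} (hr : 0 < r) (hε : 0 < ε) :
    ∫⁻ x, ENNReal.ofReal (Real.exp (-(ε * x))) ∂expMeasure r = ENNReal.ofReal (r / (r + ε)) := by
  have := isProbabilityMeasure_expMeasure hr
  have hi : Integrable (fun x => Real.exp (-(ε * x))) (expMeasure r) := by
    refine Integrable.of_bound (by fun_prop) 1 ?_
    filter_upwards [ae_pos_expMeasure r] with x hx
    rw [Real.norm_eq_abs, Real.abs_exp, Real.exp_le_one_iff]
    nlinarith
  rw [← ofReal_integral_eq_lintegral_ofReal hi (Filter.Eventually.of_forall fun x => by positivity)]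
  congr 1
  have h := integral_cexp_expMeasure hr (s := (ε : ℂ)) (by simpa using hε)
  have h2 : ∀ x : ℝ, Complex.exp (-((ε : ℂ) * (x : ℂ))) = ((Real.exp (-(ε * x)) : ℝ) : ℂ) := by
    intro x; push_cast; rfl
  simp_rw [h2] at h
  rw [integral_complex_ofReal] at h
  exact_mod_cast h

theorem expMeasure_real_Iic {r : ℝ} (hr : 0 < r) {t : ℝ} (ht : 0 ≤ t) :
    (expMeasure r).real (Set.Iic t) = 1 - Real.exp (-(r * t)) := by
  have := isProbabilityMeasure_expMeasure hr
  rw [← cdf_eq_real, cdf_expMeasure_eq hr, if_pos ht]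

theorem expMeasure_real_Iio {r : ℝ} (hr : 0 < r) {t : ℝ} (ht : 0 ≤ t) :
    (expMeasure r).real (Set.Iio t) = 1 - Real.exp (-(r * t)) := by
  have : NullMeasurableSet (Set.Iio t) (expMeasure r) := measurableSet_Iio.nullMeasurableSet
  rw [← expMeasure_real_Iic hr ht]
  have hac : expMeasure r ≪ volume := withDensity_absolutelyContinuous _ _
  exact measureReal_congr (hac.ae_le Iio_ae_eq_Iic)

/-- The mean of an exponential variable that is truncated at `t`. -/
theorem integral_min_expMeasure {r : ℝ} (hr : 0 < r) {t : ℝ} (ht : 0 ≤ t) :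
    ∫ x, max 0 (min x t) ∂expMeasure r = (1 - Real.exp (-(r * t))) / r := by
  have := isProbabilityMeasure_expMeasure hr
  have hi : Integrable (fun x => max 0 (min x t)) (expMeasure r) := by
    refine Integrable.of_bound (by fun_prop) t (Filter.Eventually.of_forall fun x => ?_)
    rw [Real.norm_eq_abs, abs_of_nonneg (le_max_left _ _)]
    exact max_le ht (min_le_right _ _)
  -- Layer-cake formula: the tail at `u` of the truncated variable is `exp (-r u)` for `u < t` and 0
  -- afterwards.
  rw [hi.integral_eq_integral_meas_lt (Filter.Eventually.of_forall fun x => le_max_left _ _)]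
  have h : ∀ u ∈ Set.Ioi (0 : ℝ), (expMeasure r).real {x | u < max 0 (min x t)} =
      (Set.Iio t).indicator (fun u => Real.exp (-(r * u))) u := by
    intro u hu
    have hu : 0 < u := hu
    by_cases hut : u < t
    · have : {x : ℝ | u < max 0 (min x t)} = (Set.Iic u)ᶜ := by
        ext x; simp [hut, hu.le]
      rw [this, probReal_compl_eq_one_sub measurableSet_Iic, expMeasure_real_Iic hr hu.le,
        Set.indicator_of_mem (show u ∈ Set.Iio t from hut)]
      ring
    · have : {x : ℝ | u < max 0 (min x t)} = ∅ := by
        ext x; simp [hut, hu.le]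
      rw [this, Set.indicator_of_notMem (show u ∉ Set.Iio t from hut)]
      simp
  rw [setIntegral_congr_fun measurableSet_Ioi h, setIntegral_indicator measurableSet_Iio,
    Set.Ioi_inter_Iio, ← integral_Ioc_eq_integral_Ioo, ← intervalIntegral.integral_of_le ht]
  have h2 : ∀ x ∈ Set.uIcc 0 t, HasDerivAt (fun u => -Real.exp (-(r * u)) / r)
      (Real.exp (-(r * x))) x := by
    intro x _
    have := (hasDerivAt_neg_exp_mul_exp (r := r) (x := x)).div_const r
    rwa [mul_div_cancel_left₀ _ hr.ne'] at this
  rw [intervalIntegral.integral_eq_sub_of_hasDerivAt h2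
    (Continuous.intervalIntegrable (by fun_prop) _ _)]
  simp
  ring

theorem integral_cexp_mul_one_sub_exp {r : ℝ} (hr : 0 < r) {s : ℂ} (hs : 0 < s.re) :
    ∫ t in Set.Ioi (0 : ℝ), Complex.exp (-(s * (t : ℂ))) * ((1 - Real.exp (-(r * t)) : ℝ) : ℂ) =
      r / (s * (r + s)) := by
  have h : ∀ t : ℝ, Complex.exp (-(s * (t : ℂ))) * ((1 - Real.exp (-(r * t)) : ℝ) : ℂ) =
      Complex.exp (-s * t) - Complex.exp (-(r + s) * t) := by
    intro t
    push_cast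
    rw [mul_sub, mul_one, ← Complex.exp_add]
    ring_nf
  have h1 : (-s).re < 0 := by simpa using hs
  have h2 : (-(r + s)).re < 0 := by simp; linarith
  have h3 : s ≠ 0 := fun h => by simp [h] at hs
  have h4 : (r : ℂ) + s ≠ 0 := fun h => by simp [h] at h2
  simp_rw [h]
  rw [integral_sub (integrableOn_exp_mul_complex_Ioi h1 0) (integrableOn_exp_mul_complex_Ioi h2 0),
    integral_exp_mul_complex_Ioi h1, integral_exp_mul_complex_Ioi h2]
  simp only [Complex.ofReal_zero, mul_zero, Complex.exp_zero, neg_div_neg_eq]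
  field_simp
  ring

end Exponential

/-! ### First-step decomposition of the chain -/

namespace CallCentre

variable {C : CallCentre}

/-- The time at which the chain enters its `n`-th state. -/
def startTime (a : C.State) (ω : C.Sample) (n : ℕ) : ℝ :=
  ∑ i ∈ Finset.range n, (ω i (chain a ω i)).1

theorem eventTime_eq_startTime (a : C.State) (ω : C.Sample) (n : ℕ) :
    eventTime a ω n = startTime a ω (n + 1) := rfl

theorem startTime_succ (a : C.State) (ω : C.Sample) (n : ℕ) :
    startTime a ω (n + 1) = startTime a ω n + (ω n (chain a ω n)).1 :=
  Finset.sum_range_succ _ _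

/-- Restarting after the first step: the path continues as that of the shifted sample from the new
state. -/
theorem chain_succ_shift (a : C.State) (ω : C.Sample) (n : ℕ) :
    chain a ω (n + 1) = chain (C.next a (ω 0 a).2) (fun i => ω (i + 1)) n := by
  induction n with
  | zero => rfl
  | succ n ih => rw [chain, ih, chain]

theorem startTime_succ_shift (a : C.State) (ω : C.Sample) (n : ℕ) :
    startTime a ω (n + 1) =
      (ω 0 a).1 + startTime (C.next a (ω 0 a).2) (fun i => ω (i + 1)) n := by
  rw [startTime, Finset.sum_range_succ', add_comm]
  congr 1
  exact Finset.sum_congr rfl fun i _ => by rw [chain_succ_shift]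

instance : IsProbabilityMeasure C.prob := by
  unfold prob
  infer_instance

instance : MeasurableSingletonClass CallEvent := ⟨fun _ => trivial⟩

variable (C) in
/-- The first holding time and event are independent of the later ones, which have the law of the
whole sequence. -/
theorem measurePreserving_firstStep (a : C.State) :
    MeasurePreserving (fun ω : C.Sample => (ω 0 a, fun n => ω (n + 1))) C.prob
      ((C.stepLaw a).prod C.prob) :=
  ((measurePreserving_eval (fun x : C.State => C.stepLaw x) a).prod (MeasurePreserving.id _)).comp
    (measurePreserving_head_tail (Measure.pi fun x : C.State => C.stepLaw x))

theorem ae_pos_stepLaw (a : C.State) : ∀ᵐ y ∂C.stepLaw a, 0 < y.1 := by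
  have := isProbabilityMeasure_expMeasure (C.totalRate_pos a)
  exact Measure.quasiMeasurePreserving_fst.ae (ae_pos_expMeasure (C.totalRate a))

variable (C) in
theorem ae_pos_prob : ∀ᵐ ω ∂C.prob, ∀ n x, 0 < (ω n x).1 := by
  refine ae_all_iff.2 fun n => ae_all_iff.2 fun x => ?_
  exact ((measurePreserving_eval (fun x : C.State => C.stepLaw x) x).comp
    (measurePreserving_eval_infinitePi _ n)).quasiMeasurePreserving.ae (ae_pos_stepLaw x)

/-! ### Rewards and their geometric decay -/

/-- Rewards `φ x (τ, e) v` that are earned while the chain is in state `x`, where `τ` is the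
holding time, `e` the event that ends it, and `v` the time that is left at its start. -/
structure IsReward (φ : C.State → ℝ × CallEvent → ℝ → ℝ) : Prop where
  measurable : ∀ x, Measurable fun p : (ℝ × CallEvent) × ℝ => φ x p.1 p.2
  -- An arbitrarily small growth rate is what gives Laplace convergence on all of `Re s > 0`.
  bound : ∀ ε : ℝ, 0 < ε → ∃ K : ℝ, 0 ≤ K ∧
    ∀ x y v, 0 < y.1 → |φ x y v| ≤ K * Real.exp (ε * v)
  eq_zero : ∀ x y v, 0 < y.1 → v ≤ 0 → φ x y v = 0

/-- The reward of the `n`-th step, for the time horizon `t`. -/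
def reward (φ : C.State → ℝ × CallEvent → ℝ → ℝ) (n : ℕ) (a : C.State) (t : ℝ)
    (ω : C.Sample) : ℝ :=
  φ (chain a ω n) (ω n (chain a ω n)) (t - startTime a ω n)

/-- The expected reward of the `n`-th step. -/
def meanReward (φ : C.State → ℝ × CallEvent → ℝ → ℝ) (n : ℕ) (a : C.State) (t : ℝ) : ℝ :=
  ∫ ω, reward φ n a t ω ∂C.prob

/-- The expected total reward. -/
def meanTotal (φ : C.State → ℝ × CallEvent → ℝ → ℝ) (a : C.State) (t : ℝ) : ℝ :=
  ∫ ω, ∑' n, reward φ n a t ω ∂C.prob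

variable {φ : C.State → ℝ × CallEvent → ℝ → ℝ}

theorem reward_zero (a : C.State) (t : ℝ) (ω : C.Sample) : reward φ 0 a t ω = φ a (ω 0 a) t := by
  simp [reward, startTime, chain]

theorem reward_succ (n : ℕ) (a : C.State) (t : ℝ) (ω : C.Sample) :
    reward φ (n + 1) a t ω =
      reward φ n (C.next a (ω 0 a).2) (t - (ω 0 a).1) (fun i => ω (i + 1)) := by
  rw [reward, reward, chain_succ_shift, startTime_succ_shift, sub_sub]

theorem measurable_comp_next {Y : Type*} [MeasurableSpace Y] {Z : Type*} [MeasurableSpace Z]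
    {g : C.State → Y → Z} (hg : ∀ x, Measurable (g x)) (a : C.State) :
    Measurable fun p : CallEvent × Y => g (C.next a p.1) p.2 :=
  measurable_from_prod_countable_right fun e => hg (C.next a e)

theorem IsReward.measurable_reward (hφ : IsReward φ) (n : ℕ) (a : C.State) :
    Measurable fun p : ℝ × C.Sample => reward φ n a p.1 p.2 := by
  induction n generalizing a with
  | zero =>
    simp_rw [reward_zero]
    exact (hφ.measurable a).comp (f := fun p : ℝ × C.Sample => (p.2 0 a, p.1)) (by fun_prop)
  | succ n ih =>
    simp_rw [reward_succ]
    exact (measurable_comp_next ih a).comp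
      (f := fun p : ℝ × C.Sample => ((p.2 0 a).2, (p.1 - (p.2 0 a).1, fun i => p.2 (i + 1))))
      (by fun_prop)

theorem IsReward.measurable_reward_right (hφ : IsReward φ) (n : ℕ) (a : C.State) (t : ℝ) :
    Measurable (reward φ n a t) :=
  (hφ.measurable_reward n a).comp measurable_prodMk_left

theorem IsReward.measurable_meanReward (hφ : IsReward φ) (n : ℕ) (a : C.State) :
    Measurable (meanReward φ n a) :=
  ((hφ.measurable_reward n a).stronglyMeasurable.integral_prod_right').measurable

theorem IsReward.measurable_firstStep (hφ : IsReward φ) (n : ℕ) (a : C.State) (t : ℝ) :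
    Measurable fun p : (ℝ × CallEvent) × C.Sample =>
      reward φ n (C.next a p.1.2) (t - p.1.1) p.2 :=
  (measurable_comp_next (hφ.measurable_reward n) a).comp
    (f := fun p : (ℝ × CallEvent) × C.Sample => (p.1.2, (t - p.1.1, p.2))) (by fun_prop)

variable (C) in
-- The quotient is the mean of `exp (-ε τ)` for the holding time `τ`; with finitely many states its
-- maximum is still below 1 and serves as the decay ratio.
theorem exists_totalRate_div_le {ε : ℝ} (hε : 0 < ε) :
    ∃ ρ : ℝ, 0 ≤ ρ ∧ ρ < 1 ∧ ∀ a, C.totalRate a / (C.totalRate a + ε) ≤ ρ := by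
  obtain ⟨b, hb⟩ := Finite.exists_max fun a => C.totalRate a / (C.totalRate a + ε)
  have := C.totalRate_pos b
  exact ⟨_, by positivity, (div_lt_one (by positivity)).2 (by linarith), hb⟩

theorem lintegral_exp_stepLaw (a : C.State) {ε : ℝ} (hε : 0 < ε) :
    ∫⁻ y, ENNReal.ofReal (Real.exp (-(ε * y.1))) ∂C.stepLaw a =
      ENNReal.ofReal (C.totalRate a / (C.totalRate a + ε)) := by
  have := isProbabilityMeasure_expMeasure (C.totalRate_pos a)
  rw [← lintegral_exp_expMeasure (C.totalRate_pos a) hε, stepLaw,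
    lintegral_prod _ (by fun_prop)]
  simp

/-- The expected reward of the `n`-th step decays geometrically in `n`, and grows with the time
horizon at an exponential rate as small as one likes. -/
theorem IsReward.exists_lintegral_reward_le (hφ : IsReward φ) {ε : ℝ} (hε : 0 < ε) :
    ∃ K ρ : ℝ, 0 ≤ K ∧ 0 ≤ ρ ∧ ρ < 1 ∧ ∀ n a t,
      ∫⁻ ω, ‖reward φ n a t ω‖ₑ ∂C.prob ≤ ENNReal.ofReal (K * ρ ^ n * Real.exp (ε * t)) := by
  obtain ⟨K, hK, hb⟩ := hφ.bound ε hε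
  obtain ⟨ρ, hρ, hρ1, hr⟩ := exists_totalRate_div_le C hε
  refine ⟨K, ρ, hK, hρ, hρ1, fun n => ?_⟩
  induction n with
  | zero =>
    intro a t
    calc ∫⁻ ω, ‖reward φ 0 a t ω‖ₑ ∂C.prob
        ≤ ∫⁻ ω, ENNReal.ofReal (K * Real.exp (ε * t)) ∂C.prob := by
          refine lintegral_mono_ae ?_
          filter_upwards [ae_pos_prob C] with ω hω
          rw [reward_zero, Real.enorm_eq_ofReal_abs]
          exact ENNReal.ofReal_le_ofReal (hb _ _ _ (hω 0 a))
      _ = _ := by simp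
  | succ n ih =>
    intro a t
    have hm := hφ.measurable_firstStep n a t
    calc ∫⁻ ω, ‖reward φ (n + 1) a t ω‖ₑ ∂C.prob
        = ∫⁻ p, ‖reward φ n (C.next a p.1.2) (t - p.1.1) p.2‖ₑ
            ∂((C.stepLaw a).prod C.prob) := by
          rw [← (measurePreserving_firstStep C a).lintegral_comp hm.enorm]
          simp_rw [reward_succ]
      _ = ∫⁻ y, ∫⁻ ω, ‖reward φ n (C.next a y.2) (t - y.1) ω‖ₑ ∂C.prob ∂C.stepLaw a :=
          lintegral_prod _ hm.enorm.aemeasurable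
      _ ≤ ∫⁻ y, ENNReal.ofReal (K * ρ ^ n * Real.exp (ε * t)) *
            ENNReal.ofReal (Real.exp (-(ε * y.1))) ∂C.stepLaw a := by
          -- The induction bound at horizon `t - τ` splits as `exp (ε t) * exp (-ε τ)`; averaging
          -- the second factor gains one more `ρ`.
          refine lintegral_mono fun y => (ih _ _).trans_eq ?_
          rw [← ENNReal.ofReal_mul (by positivity), mul_assoc (K * ρ ^ n), ← Real.exp_add]
          ring_nf
      _ = ENNReal.ofReal (K * ρ ^ n * Real.exp (ε * t)) *
            ENNReal.ofReal (C.totalRate a / (C.totalRate a + ε)) := by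
          rw [lintegral_const_mul _ (by fun_prop), lintegral_exp_stepLaw a hε]
      _ ≤ ENNReal.ofReal (K * ρ ^ (n + 1) * Real.exp (ε * t)) := by
          rw [← ENNReal.ofReal_mul (by positivity)]
          refine ENNReal.ofReal_le_ofReal ?_
          calc _ ≤ K * ρ ^ n * Real.exp (ε * t) * ρ := by gcongr; exact hr a
            _ = _ := by ring

theorem IsReward.integrable_reward (hφ : IsReward φ) (n : ℕ) (a : C.State) (t : ℝ) :
    Integrable (reward φ n a t) C.prob := by
  obtain ⟨K, ρ, -, -, -, h⟩ := hφ.exists_lintegral_reward_le one_pos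
  exact ⟨(hφ.measurable_reward_right n a t).aestronglyMeasurable,
    (h n a t).trans_lt ENNReal.ofReal_lt_top⟩

theorem IsReward.exists_integral_norm_reward_le (hφ : IsReward φ) {ε : ℝ} (hε : 0 < ε) :
    ∃ K ρ : ℝ, 0 ≤ K ∧ 0 ≤ ρ ∧ ρ < 1 ∧ ∀ n a t,
      ∫ ω, ‖reward φ n a t ω‖ ∂C.prob ≤ K * ρ ^ n * Real.exp (ε * t) := by
  obtain ⟨K, ρ, hK, hρ, hρ1, h⟩ := hφ.exists_lintegral_reward_le hε
  refine ⟨K, ρ, hK, hρ, hρ1, fun n a t => ?_⟩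
  rw [integral_norm_eq_lintegral_enorm (hφ.integrable_reward n a t).1]
  exact ENNReal.toReal_le_of_le_ofReal (by positivity) (h n a t)

theorem IsReward.summable_integral_norm_reward (hφ : IsReward φ) (a : C.State) (t : ℝ) :
    Summable fun n => ∫ ω, ‖reward φ n a t ω‖ ∂C.prob := by
  obtain ⟨K, ρ, -, hρ, hρ1, h⟩ := hφ.exists_integral_norm_reward_le one_pos
  refine Summable.of_nonneg_of_le (fun n => by positivity) (fun n => h n a t) ?_
  exact ((summable_geometric_of_lt_one hρ hρ1).mul_left K).mul_right _

theorem IsReward.tsum_lintegral_reward_ne_top (hφ : IsReward φ) (a : C.State) (t : ℝ) :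
    ∑' n, ∫⁻ ω, ‖reward φ n a t ω‖ₑ ∂C.prob ≠ ⊤ := by
  obtain ⟨K, ρ, hK, hρ, hρ1, h⟩ := hφ.exists_lintegral_reward_le one_pos
  refine ne_top_of_le_ne_top ?_ (ENNReal.tsum_le_tsum fun n => h n a t)
  exact (((summable_geometric_of_lt_one hρ hρ1).mul_left K).mul_right _).tsum_ofReal_ne_top

theorem IsReward.ae_summable_reward (hφ : IsReward φ) (a : C.State) (t : ℝ) :
    ∀ᵐ ω ∂C.prob, Summable fun n => reward φ n a t ω := by
  have h := summable_norm_of_tsum_eLpNorm_ne_top (μ := C.prob) le_rfl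
    (fun n => (hφ.measurable_reward_right n a t).aestronglyMeasurable)
    (by simpa only [eLpNorm_one_eq_lintegral_enorm] using hφ.tsum_lintegral_reward_ne_top a t)
  filter_upwards [h] with ω hω using hω.of_norm

theorem IsReward.integrable_tsum_reward (hφ : IsReward φ) (a : C.State) (t : ℝ) :
    Integrable (fun ω => ∑' n, reward φ n a t ω) C.prob := by
  have hm : ∀ n, Measurable (reward φ n a t) := fun n => hφ.measurable_reward_right n a t
  refine ⟨?_, ?_⟩
  · refine aestronglyMeasurable_of_tendsto_ae Filter.atTop
      (f := fun N ω => ∑ n ∈ Finset.range N, reward φ n a t ω)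
      (fun _ => (Finset.measurable_fun_sum _ fun n _ => hm n).aestronglyMeasurable) ?_
    filter_upwards [hφ.ae_summable_reward a t] with ω hω using hω.hasSum.tendsto_sum_nat
  · refine lt_of_le_of_lt (lintegral_mono fun ω => enorm_tsum_le_tsum_enorm) ?_
    rw [lintegral_tsum fun n => (hm n).enorm.aemeasurable]
    exact (hφ.tsum_lintegral_reward_ne_top a t).lt_top

theorem IsReward.hasSum_meanReward (hφ : IsReward φ) (a : C.State) (t : ℝ) :
    HasSum (fun n => meanReward φ n a t) (meanTotal φ a t) :=
  hasSum_integral_of_summable_integral_norm (fun n => hφ.integrable_reward n a t)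
    (hφ.summable_integral_norm_reward a t)

theorem IsReward.measurable_meanTotal (hφ : IsReward φ) (a : C.State) :
    Measurable (meanTotal φ a) :=
  measurable_of_tendsto_metrizable
    (f := fun (N : ℕ) t => ∑ n ∈ Finset.range N, meanReward φ n a t)
    (fun _ => Finset.measurable_fun_sum _ fun n _ => hφ.measurable_meanReward n a)
    (tendsto_pi_nhds.2 fun t => (hφ.hasSum_meanReward a t).tendsto_sum_nat)

theorem IsReward.exists_abs_meanReward_le (hφ : IsReward φ) {ε : ℝ} (hε : 0 < ε) :
    ∃ K ρ : ℝ, 0 ≤ K ∧ 0 ≤ ρ ∧ ρ < 1 ∧ ∀ n a t,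
      |meanReward φ n a t| ≤ K * ρ ^ n * Real.exp (ε * t) := by
  obtain ⟨K, ρ, hK, hρ, hρ1, h⟩ := hφ.exists_integral_norm_reward_le hε
  exact ⟨K, ρ, hK, hρ, hρ1, fun n a t => (norm_integral_le_integral_norm _).trans (h n a t)⟩

theorem IsReward.exists_abs_meanTotal_le (hφ : IsReward φ) {ε : ℝ} (hε : 0 < ε) :
    ∃ K : ℝ, 0 ≤ K ∧ ∀ a t, |meanTotal φ a t| ≤ K * Real.exp (ε * t) := by
  obtain ⟨K, ρ, hK, hρ, hρ1, h⟩ := hφ.exists_abs_meanReward_le hε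
  refine ⟨K * (1 - ρ)⁻¹, mul_nonneg hK (inv_nonneg.2 (by linarith)), fun a t => ?_⟩
  rw [← (hφ.hasSum_meanReward a t).tsum_eq]
  exact tsum_of_norm_bounded (((hasSum_geometric_of_lt_one hρ hρ1).mul_left K).mul_right _)
    fun n => (Real.norm_eq_abs _).trans_le (h n a t)

/-! ### The renewal equation -/

theorem meanReward_zero (hφ : IsReward φ) (a : C.State) (t : ℝ) :
    meanReward φ 0 a t = ∫ y, φ a y t ∂C.stepLaw a := by
  have hm : Measurable fun y => φ a y t :=
    (hφ.measurable a).comp (f := fun y : ℝ × CallEvent => (y, t)) (by fun_prop)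
  have h := (measurePreserving_eval (fun x : C.State => C.stepLaw x) a).comp
    (measurePreserving_eval_infinitePi (fun _ : ℕ => Measure.pi fun x : C.State => C.stepLaw x) 0)
  simp_rw [meanReward, reward_zero]
  conv_rhs => rw [← h.map_eq]
  exact (integral_map h.measurable.aemeasurable hm.aestronglyMeasurable).symm

theorem meanReward_succ (hφ : IsReward φ) (n : ℕ) (a : C.State) (t : ℝ) :
    meanReward φ (n + 1) a t = ∫ y, meanReward φ n (C.next a y.2) (t - y.1) ∂C.stepLaw a := by
  have hm := (hφ.measurable_firstStep n a t).aestronglyMeasurable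
    (μ := (C.stepLaw a).prod C.prob)
  have hp := measurePreserving_firstStep C a
  have hi : Integrable (fun p : (ℝ × CallEvent) × C.Sample =>
      reward φ n (C.next a p.1.2) (t - p.1.1) p.2) ((C.stepLaw a).prod C.prob) := by
    rw [← hp.integrable_comp hm]
    refine (hφ.integrable_reward (n + 1) a t).congr (Filter.Eventually.of_forall fun ω => ?_)
    rw [reward_succ]
    rfl
  simp_rw [meanReward, reward_succ]
  rw [← integral_prod _ hi, ← hp.map_eq, integral_map hp.measurable.aemeasurable
    (by rw [hp.map_eq]; exact hm)]

/-- Vanishing for `t ≤ 0` lets Laplace integrals run over the whole line, where translation by a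
holding time is harmless. -/
theorem meanReward_of_nonpos (hφ : IsReward φ) (n : ℕ) (a : C.State) {t : ℝ} (ht : t ≤ 0) :
    meanReward φ n a t = 0 := by
  induction n generalizing a t with
  | zero =>
    rw [meanReward_zero hφ]
    refine integral_eq_zero_of_ae ?_
    filter_upwards [ae_pos_stepLaw a] with y hy using hφ.eq_zero _ _ _ hy ht
  | succ n ih =>
    rw [meanReward_succ hφ]
    refine integral_eq_zero_of_ae ?_
    filter_upwards [ae_pos_stepLaw a] with y hy using ih _ (by linarith)

theorem meanTotal_of_nonpos (hφ : IsReward φ) (a : C.State) {t : ℝ} (ht : t ≤ 0) :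
    meanTotal φ a t = 0 := by
  rw [← (hφ.hasSum_meanReward a t).tsum_eq]
  simp [meanReward_of_nonpos hφ _ a ht]

theorem IsReward.measurable_next_meanTotal (hφ : IsReward φ) (a : C.State) :
    Measurable fun p : ℝ × ℝ × CallEvent => meanTotal φ (C.next a p.2.2) (p.1 - p.2.1) :=
  (measurable_comp_next hφ.measurable_meanTotal a).comp
    (f := fun p : ℝ × ℝ × CallEvent => (p.2.2, p.1 - p.2.1)) (by fun_prop)

/-- The renewal equation. -/
theorem meanTotal_eq (hφ : IsReward φ) (a : C.State) (t : ℝ) :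
    meanTotal φ a t = (∫ y, φ a y t ∂C.stepLaw a) +
      ∫ y, meanTotal φ (C.next a y.2) (t - y.1) ∂C.stepLaw a := by
  have hs := hφ.hasSum_meanReward a t
  rw [← hs.tsum_eq, hs.summable.tsum_eq_zero_add, meanReward_zero hφ]
  congr 1
  simp_rw [meanReward_succ hφ, ← (hφ.hasSum_meanReward _ _).tsum_eq]
  obtain ⟨K, ρ, hK, hρ, hρ1, h⟩ := hφ.exists_abs_meanReward_le one_pos
  have hb : ∀ n, ∀ᵐ y ∂C.stepLaw a, ‖meanReward φ n (C.next a y.2) (t - y.1)‖ ≤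
      K * ρ ^ n * Real.exp t := by
    intro n
    filter_upwards [ae_pos_stepLaw a] with y hy
    refine (h n _ _).trans ?_
    gcongr
    linarith
  have hm : ∀ n, Measurable fun y : ℝ × CallEvent =>
      meanReward φ n (C.next a y.2) (t - y.1) := fun n =>
    (measurable_comp_next (hφ.measurable_meanReward n) a).comp
      (f := fun y : ℝ × CallEvent => (y.2, t - y.1)) (by fun_prop)
  have hi : ∀ n, Integrable (fun y : ℝ × CallEvent =>
      meanReward φ n (C.next a y.2) (t - y.1)) (C.stepLaw a) := fun n =>
    Integrable.of_bound (hm n).aestronglyMeasurable _ (hb n)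
  refine integral_tsum_of_summable_integral_norm hi ?_
  refine Summable.of_nonneg_of_le (fun n => by positivity) (fun n => ?_)
    (((summable_geometric_of_lt_one hρ hρ1).mul_left K).mul_right (Real.exp t))
  refine (integral_mono_ae (hi n).norm (integrable_const _) (hb n)).trans_eq ?_
  simp

/-- Expected total rewards are proportional if the expected rewards of a single step are. -/
theorem meanTotal_proportional {ψ : C.State → ℝ × CallEvent → ℝ → ℝ} (hφ : IsReward φ)
    (hψ : IsReward ψ) {c : ℝ}
    (h : ∀ a t, ∫ y, φ a y t ∂C.stepLaw a = c * ∫ y, ψ a y t ∂C.stepLaw a) (a : C.State) (t : ℝ) :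
    meanTotal φ a t = c * meanTotal ψ a t := by
  have hn : ∀ n a t, meanReward φ n a t = c * meanReward ψ n a t := by
    intro n
    induction n with
    | zero => intro a t; rw [meanReward_zero hφ, meanReward_zero hψ, h]
    | succ n ih =>
      intro a t
      simp_rw [meanReward_succ hφ, meanReward_succ hψ, ih, integral_const_mul]
  rw [← (hφ.hasSum_meanReward a t).tsum_eq, ← ((hψ.hasSum_meanReward a t).mul_left c).tsum_eq]
  exact tsum_congr fun n => hn n a t

/-! ### Laplace transform of the renewal equation -/

theorem laplaceConverges_of_abs_le {f : ℝ → ℝ} (hf : Measurable f) {s : ℂ} {K ε : ℝ}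
    (hε : ε < s.re) (h : ∀ t, |f t| ≤ K * Real.exp (ε * t)) : LaplaceConverges f s := by
  have hi := (integrableOn_exp_mul_Ioi (a := ε - s.re) (by linarith) 0).const_mul K
  refine Integrable.mono' hi (by fun_prop) (Filter.Eventually.of_forall fun t => ?_)
  rw [norm_mul, Complex.norm_exp, Complex.norm_real, Real.norm_eq_abs]
  calc Real.exp (-(s * (t : ℂ))).re * |f t|
      ≤ Real.exp (-(s * (t : ℂ))).re * (K * Real.exp (ε * t)) := by gcongr; exact h t
    _ = K * Real.exp ((ε - s.re) * t) := by
        rw [mul_left_comm, ← Real.exp_add]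
        congr 2
        simp
        ring

theorem exp_mul_eq_zero_of_nonpos {f : ℝ → ℝ} (hf : ∀ t ≤ 0, f t = 0) (s : ℂ) :
    ∀ t, t ∉ Set.Ioi (0 : ℝ) → Complex.exp (-(s * (t : ℂ))) * ((f t : ℝ) : ℂ) = 0 := fun t ht => by
  rw [hf t (not_lt.1 ht), Complex.ofReal_zero, mul_zero]

theorem laplace_eq_integral {f : ℝ → ℝ} (hf : ∀ t ≤ 0, f t = 0) (s : ℂ) :
    laplace f s = ∫ t : ℝ, Complex.exp (-(s * (t : ℂ))) * ((f t : ℝ) : ℂ) :=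
  setIntegral_eq_integral_of_forall_compl_eq_zero (exp_mul_eq_zero_of_nonpos hf s)

theorem LaplaceConverges.integrable {f : ℝ → ℝ} {s : ℂ} (h : LaplaceConverges f s)
    (hf : ∀ t ≤ 0, f t = 0) :
    Integrable fun t : ℝ => Complex.exp (-(s * (t : ℂ))) * ((f t : ℝ) : ℂ) :=
  (integrableOn_iff_integrable_of_support_subset fun t ht => by
    by_contra h'
    exact ht (exp_mul_eq_zero_of_nonpos hf s t h')).1 h

/-- Delaying by `τ` costs the factor `exp (-s τ)`; this turns the renewal convolution into a
product. -/
theorem exp_mul_comp_sub (f : ℝ → ℝ) (s : ℂ) (τ t : ℝ) :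
    Complex.exp (-(s * (t : ℂ))) * ((f (t - τ) : ℝ) : ℂ) = Complex.exp (-(s * (τ : ℂ))) *
      (Complex.exp (-(s * ((t - τ : ℝ) : ℂ))) * ((f (t - τ) : ℝ) : ℂ)) := by
  rw [← mul_assoc, ← Complex.exp_add]
  congr 2
  push_cast
  ring

theorem norm_exp_le_one {s : ℂ} (hs : 0 < s.re) {τ : ℝ} (hτ : 0 < τ) :
    ‖Complex.exp (-(s * (τ : ℂ)))‖ ≤ 1 := by
  rw [Complex.norm_exp, Real.exp_le_one_iff]
  simp
  positivity

/-- In the step law the holding time and the event are independent. -/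
theorem integral_stepLaw_mul {𝕜 : Type*} [RCLike 𝕜] (a : C.State) (f : ℝ → 𝕜)
    (g : CallEvent → 𝕜) :
    ∫ y, f y.1 * g y.2 ∂C.stepLaw a = (∫ τ, f τ ∂expMeasure (C.totalRate a)) *
      ∑ e, ((C.rate a e / C.totalRate a : ℝ) : 𝕜) * g e := by
  have := isProbabilityMeasure_expMeasure (C.totalRate_pos a)
  rw [stepLaw, integral_prod_mul, PMF.integral_eq_sum]
  congr 1
  refine Finset.sum_congr rfl fun e _ => ?_
  rw [eventPMF, PMF.ofFintype_apply,
    ENNReal.toReal_ofReal (div_nonneg (C.rate_nonneg a e) (C.totalRate_pos a).le),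
    RCLike.real_smul_eq_coe_mul]

theorem IsReward.laplaceConverges_meanTotal (hφ : IsReward φ) (a : C.State) {s : ℂ}
    (hs : 0 < s.re) : LaplaceConverges (meanTotal φ a) s := by
  obtain ⟨K, -, h⟩ := hφ.exists_abs_meanTotal_le (half_pos hs)
  exact laplaceConverges_of_abs_le (hφ.measurable_meanTotal a) (half_lt_self hs) (h a)

theorem IsReward.laplaceConverges_meanReward (hφ : IsReward φ) (n : ℕ) (a : C.State) {s : ℂ}
    (hs : 0 < s.re) : LaplaceConverges (meanReward φ n a) s := by
  obtain ⟨K, ρ, -, -, -, h⟩ := hφ.exists_abs_meanReward_le (half_pos hs)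
  exact laplaceConverges_of_abs_le (hφ.measurable_meanReward n a) (half_lt_self hs) (h n a)

/-- Justifies Fubini over time and first step. For a fixed first step the norm integral is `‖exp (-s
τ)‖ ≤ 1` times one of finitely many constants, indexed by the event. -/
theorem IsReward.integrable_renewal (hφ : IsReward φ) (a : C.State) {s : ℂ} (hs : 0 < s.re) :
    Integrable (fun p : ℝ × ℝ × CallEvent => Complex.exp (-(s * (p.1 : ℂ))) *
      ((meanTotal φ (C.next a p.2.2) (p.1 - p.2.1) : ℝ) : ℂ)) (volume.prod (C.stepLaw a)) := by
  have hm : Measurable (fun p : ℝ × ℝ × CallEvent => Complex.exp (-(s * (p.1 : ℂ))) *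
      ((meanTotal φ (C.next a p.2.2) (p.1 - p.2.1) : ℝ) : ℂ)) :=
    (by fun_prop : Measurable fun p : ℝ × ℝ × CallEvent => Complex.exp (-(s * (p.1 : ℂ)))).mul
      (Complex.measurable_ofReal.comp (hφ.measurable_next_meanTotal a))
  have hi : ∀ x, Integrable fun t : ℝ =>
      Complex.exp (-(s * (t : ℂ))) * ((meanTotal φ x t : ℝ) : ℂ) := fun x =>
    (hφ.laplaceConverges_meanTotal x hs).integrable fun t ht => meanTotal_of_nonpos hφ x ht
  rw [integrable_prod_iff' hm.aestronglyMeasurable]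
  constructor
  · refine Filter.Eventually.of_forall fun y => ?_
    simp_rw [exp_mul_comp_sub (meanTotal φ (C.next a y.2)) s y.1]
    exact ((hi (C.next a y.2)).comp_sub_right y.1).const_mul _
  · have h : ∀ y : ℝ × CallEvent, ∫ t : ℝ, ‖Complex.exp (-(s * (t : ℂ))) *
        ((meanTotal φ (C.next a y.2) (t - y.1) : ℝ) : ℂ)‖ = ‖Complex.exp (-(s * (y.1 : ℂ)))‖ *
          ∫ t : ℝ, ‖Complex.exp (-(s * (t : ℂ))) * ((meanTotal φ (C.next a y.2) t : ℝ) : ℂ)‖ := by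
      intro y
      simp_rw [exp_mul_comp_sub (meanTotal φ (C.next a y.2)) s y.1]
      simp_rw [norm_mul (Complex.exp (-(s * (y.1 : ℂ))))]
      rw [integral_const_mul, integral_sub_right_eq_self (fun t : ℝ => ‖Complex.exp (-(s * (t : ℂ))) *
        ((meanTotal φ (C.next a y.2) t : ℝ) : ℂ)‖)]
    simp_rw [h]
    set M : CallEvent → ℝ := fun e => ∫ t : ℝ, ‖Complex.exp (-(s * (t : ℂ))) *
      ((meanTotal φ (C.next a e) t : ℝ) : ℂ)‖
    have hM0 : ∀ e, 0 ≤ M e := fun e => integral_nonneg fun t => norm_nonneg _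
    refine Integrable.of_bound (C := ∑ e, M e) ?_ ?_
    · exact (by fun_prop : Measurable fun y : ℝ × CallEvent =>
        ‖Complex.exp (-(s * (y.1 : ℂ)))‖).aestronglyMeasurable.mul
        ((measurable_of_countable M).comp measurable_snd).aestronglyMeasurable
    · filter_upwards [ae_pos_stepLaw a] with y hy
      rw [norm_mul, norm_norm, Real.norm_of_nonneg (hM0 _)]
      refine (mul_le_of_le_one_left (hM0 _) (norm_exp_le_one hs hy)).trans ?_
      exact Finset.single_le_sum (fun e _ => hM0 e) (Finset.mem_univ y.2)

theorem totalRate_add_ne_zero (a : C.State) {s : ℂ} (hs : 0 < s.re) :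
    (C.totalRate a : ℂ) + s ≠ 0 := fun h => by
  have := congrArg Complex.re h
  simp at this
  linarith [C.totalRate_pos a]

/-- The renewal equation for Laplace transforms. -/
theorem laplace_meanTotal (hφ : IsReward φ) (a : C.State) {s : ℂ} (hs : 0 < s.re) :
    (C.totalRate a + s) * laplace (meanTotal φ a) s =
      (C.totalRate a + s) * laplace (meanReward φ 0 a) s +
        ∑ e, (C.rate a e : ℂ) * laplace (meanTotal φ (C.next a e)) s := by
  have hz : ∀ x, ∀ t ≤ 0, meanTotal φ x t = 0 := fun x t ht => meanTotal_of_nonpos hφ x ht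
  have hz0 : ∀ t ≤ 0, meanReward φ 0 a t = 0 := fun t ht => meanReward_of_nonpos hφ 0 a ht
  have hI := hφ.integrable_renewal a hs
  have hd : ∀ t : ℝ, Complex.exp (-(s * (t : ℂ))) * ((meanTotal φ a t : ℝ) : ℂ) =
      Complex.exp (-(s * (t : ℂ))) * ((meanReward φ 0 a t : ℝ) : ℂ) +
      ∫ y, Complex.exp (-(s * (t : ℂ))) * ((meanTotal φ (C.next a y.2) (t - y.1) : ℝ) : ℂ)
        ∂C.stepLaw a := by
    intro t
    rw [meanTotal_eq hφ, ← meanReward_zero hφ, integral_const_mul, integral_complex_ofReal]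
    push_cast
    ring
  -- After the swap, the inner integral is `exp (-s τ)` times the transform from the next state;
  -- independence of `τ` and the event separates the two means.
  have hf : ∫ t : ℝ, ∫ y, Complex.exp (-(s * (t : ℂ))) *
      ((meanTotal φ (C.next a y.2) (t - y.1) : ℝ) : ℂ) ∂C.stepLaw a =
      C.totalRate a / (C.totalRate a + s) * ∑ e, ((C.rate a e / C.totalRate a : ℝ) : ℂ) *
        laplace (meanTotal φ (C.next a e)) s := by
    rw [integral_integral_swap hI, ← integral_cexp_expMeasure (C.totalRate_pos a) hs]
    refine Eq.trans (integral_congr_ae (Filter.Eventually.of_forall fun y => ?_))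
      (integral_stepLaw_mul a (fun τ : ℝ => Complex.exp (-(s * (τ : ℂ))))
        (fun e => laplace (meanTotal φ (C.next a e)) s))
    simp only
    simp_rw [exp_mul_comp_sub (meanTotal φ (C.next a y.2)) s y.1]
    rw [integral_const_mul, laplace_eq_integral (hz _),
      integral_sub_right_eq_self (fun t : ℝ => Complex.exp (-(s * (t : ℂ))) *
        ((meanTotal φ (C.next a y.2) t : ℝ) : ℂ))]
  have hR : (C.totalRate a : ℂ) ≠ 0 := by exact_mod_cast (C.totalRate_pos a).ne'
  have hRs := totalRate_add_ne_zero a hs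
  rw [laplace_eq_integral (hz a), laplace_eq_integral hz0]
  simp_rw [hd]
  rw [integral_add ((hφ.laplaceConverges_meanReward 0 a hs).integrable hz0) hI.integral_prod_left,
    hf, mul_add, ← mul_assoc, mul_div_cancel₀ _ hRs, Finset.mul_sum]
  congr 1
  refine Finset.sum_congr rfl fun e _ => ?_
  push_cast
  field_simp

/-! ### The event and waiting rewards -/

/-- The reward that pays `c x e` for an event `e` in state `x`. -/
def eventReward (c : C.State → CallEvent → ℝ) (x : C.State) (y : ℝ × CallEvent) (v : ℝ) : ℝ :=
  if y.1 < v then c x y.2 else 0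

/-- The reward that pays the number of waiting callers per unit of time. -/
def waitReward (x : C.State) (y : ℝ × CallEvent) (v : ℝ) : ℝ :=
  C.waiting x * max 0 (min y.1 v)

theorem waiting_nonneg (x : C.State) : 0 ≤ C.waiting x := le_max_left _ _

theorem isReward_eventReward (c : C.State → CallEvent → ℝ) : IsReward (eventReward c) where
  measurable x := Measurable.ite (measurableSet_lt (by fun_prop) (by fun_prop))
    ((measurable_of_countable (c x)).comp (by fun_prop)) measurable_const
  bound ε hε := by
    refine ⟨∑ x, ∑ e, |c x e|, by positivity, fun x y v hy => ?_⟩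
    unfold eventReward
    split_ifs with h
    · have h1 : |c x y.2| ≤ ∑ x, ∑ e, |c x e| :=
        (Finset.single_le_sum (f := fun e => |c x e|) (fun e _ => abs_nonneg _)
          (Finset.mem_univ y.2)).trans
          (Finset.single_le_sum (f := fun x => ∑ e, |c x e|) (fun x _ => by positivity)
            (Finset.mem_univ x))
      have h2 : 1 ≤ Real.exp (ε * v) := Real.one_le_exp (mul_pos hε (hy.trans h)).le
      exact h1.trans (le_mul_of_one_le_right (by positivity) h2)
    · rw [abs_zero]
      positivity
  eq_zero x y v hy hv := if_neg (by linarith)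

theorem isReward_waitReward : IsReward (waitReward (C := C)) where
  measurable x := by unfold waitReward; fun_prop
  bound ε hε := by
    refine ⟨(∑ x, C.waiting x) / ε,
      div_nonneg (Finset.sum_nonneg fun x _ => waiting_nonneg x) hε.le, fun x y v hy => ?_⟩
    have h1 : C.waiting x ≤ ∑ x, C.waiting x :=
      Finset.single_le_sum (fun x _ => waiting_nonneg x) (Finset.mem_univ x)
    -- Linear growth is absorbed by `ε v + 1 ≤ exp (ε v)`, hence the constant divided by `ε`.
    have h2 : max 0 (min y.1 v) ≤ Real.exp (ε * v) / ε := by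
      refine max_le (by positivity) ((min_le_right _ _).trans ?_)
      rw [le_div_iff₀ hε]
      linarith [Real.add_one_le_exp (ε * v)]
    have h3 : (0 : ℝ) ≤ max 0 (min y.1 v) := le_max_left _ _
    rw [waitReward, abs_of_nonneg (mul_nonneg (waiting_nonneg x) h3), div_mul_eq_mul_div,
      ← mul_div_assoc']
    exact mul_le_mul h1 h2 h3 (Finset.sum_nonneg fun x _ => waiting_nonneg x)
  eq_zero x y v hy hv := by
    rw [waitReward, max_eq_left ((min_le_right _ _).trans hv), mul_zero]

theorem meanReward_eventReward (c : C.State → CallEvent → ℝ) (a : C.State) {t : ℝ} (ht : 0 ≤ t) :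
    meanReward (eventReward c) 0 a t =
      (∑ e, C.rate a e * c a e) / C.totalRate a * (1 - Real.exp (-(C.totalRate a * t))) := by
  have h : ∀ y, eventReward c a y t = (Set.Iio t).indicator 1 y.1 * c a y.2 := fun y => by
    by_cases hy : y.1 < t <;> simp [eventReward, hy]
  rw [meanReward_zero (isReward_eventReward c)]
  simp_rw [h]
  rw [integral_stepLaw_mul a ((Set.Iio t).indicator 1) (c a), integral_indicator_one measurableSet_Iio,
    expMeasure_real_Iio (C.totalRate_pos a) ht, mul_comm, Finset.sum_div]
  simp [div_mul_eq_mul_div]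

theorem meanReward_waitReward (a : C.State) {t : ℝ} (ht : 0 ≤ t) :
    meanReward waitReward 0 a t =
      C.waiting a / C.totalRate a * (1 - Real.exp (-(C.totalRate a * t))) := by
  have := isProbabilityMeasure_expMeasure (C.totalRate_pos a)
  have h : ∫ y, max 0 (min y.1 t) ∂C.stepLaw a =
      ∫ τ, max 0 (min τ t) ∂expMeasure (C.totalRate a) :=
    integral_fun_fst (μ := expMeasure (C.totalRate a)) (ν := (C.eventPMF a).toMeasure)
      (fun τ : ℝ => max 0 (min τ t)) |>.trans (by simp)
  rw [meanReward_zero isReward_waitReward]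
  simp_rw [waitReward]
  rw [integral_const_mul, h, integral_min_expMeasure (C.totalRate_pos a) ht]
  ring

/-- Here `G` is the rate at which reward accrues in the state; it supplies the inhomogeneous term `G
/ s` of the linear system. -/
theorem laplace_of_eq_one_sub_exp {f : ℝ → ℝ} {r G : ℝ} (hr : 0 < r)
    (hf : ∀ t, 0 ≤ t → f t = G / r * (1 - Real.exp (-(r * t)))) {s : ℂ} (hs : 0 < s.re) :
    (r + s) * laplace f s = G / s := by
  have h : laplace f s = ((G / r : ℝ) : ℂ) * ∫ t in Set.Ioi (0 : ℝ),
      Complex.exp (-(s * (t : ℂ))) * ((1 - Real.exp (-(r * t)) : ℝ) : ℂ) := by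
    rw [laplace, ← integral_const_mul]
    refine setIntegral_congr_fun measurableSet_Ioi fun t ht => ?_
    rw [hf t (le_of_lt ht), Complex.ofReal_mul]
    ring
  have h3 : s ≠ 0 := fun h => by simp [h] at hs
  have h4 : (r : ℂ) + s ≠ 0 := fun h => by
    have := congrArg Complex.re h
    simp at this
    linarith
  have h5 : (r : ℂ) ≠ 0 := by exact_mod_cast hr.ne'
  rw [h, integral_cexp_mul_one_sub_exp hr hs]
  push_cast
  field_simp

theorem laplace_meanTotal_eventReward (c : C.State → CallEvent → ℝ) (a : C.State) {s : ℂ}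
    (hs : 0 < s.re) :
    (C.totalRate a + s) * laplace (meanTotal (eventReward c) a) s =
      ((∑ e, C.rate a e * c a e : ℝ) : ℂ) / s +
        ∑ e, (C.rate a e : ℂ) * laplace (meanTotal (eventReward c) (C.next a e)) s := by
  rw [laplace_meanTotal (isReward_eventReward c) a hs, laplace_of_eq_one_sub_exp
    (C.totalRate_pos a) (fun t ht => meanReward_eventReward c a ht) hs]

theorem laplace_meanTotal_waitReward (a : C.State) {s : ℂ} (hs : 0 < s.re) :
    (C.totalRate a + s) * laplace (meanTotal waitReward a) s = (C.waiting a : ℂ) / s +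
        ∑ e, (C.rate a e : ℂ) * laplace (meanTotal waitReward (C.next a e)) s := by
  rw [laplace_meanTotal isReward_waitReward a hs, laplace_of_eq_one_sub_exp
    (C.totalRate_pos a) (fun t ht => meanReward_waitReward a ht) hs]

/-! ### Identifying costs and waiting time with total rewards, path by path -/

theorem strictMono_startTime (a : C.State) {ω : C.Sample} (hω : ∀ n x, 0 < (ω n x).1) :
    StrictMono (startTime a ω) :=
  strictMono_nat_of_lt_succ fun n => by
    rw [startTime_succ]
    linarith [hω n (chain a ω n)]

theorem startTime_nonneg (a : C.State) {ω : C.Sample} (hω : ∀ n x, 0 < (ω n x).1) (n : ℕ) :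
    0 ≤ startTime a ω n :=
  Finset.sum_nonneg fun i _ => (hω i _).le

theorem eventSum_eq_tsum_reward (c : C.State → CallEvent → ℝ) (a : C.State) (t : ℝ)
    {ω : C.Sample} (hω : ∀ n x, 0 < (ω n x).1) :
    eventSum c a t ω = ∑' n, reward (eventReward c) n a t ω := by
  refine tsum_congr fun n => ?_
  have h0 : 0 < eventTime a ω n :=
    (startTime_nonneg a hω n).trans_lt (strictMono_startTime a hω n.lt_succ_self)
  have h : eventTime a ω n ∈ Set.Ioo 0 t ↔ (ω n (chain a ω n)).1 < t - startTime a ω n := by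
    rw [Set.mem_Ioo, and_iff_right h0, eventTime_eq_startTime, startTime_succ, lt_sub_iff_add_lt']
  by_cases ht : (ω n (chain a ω n)).1 < t - startTime a ω n
  · rw [if_pos (h.2 ht), reward, eventReward, if_pos ht, event]
  · rw [if_neg (fun h' => ht (h.1 h')), reward, eventReward, if_neg ht]

/-- Paying 1 per event gives an almost surely summable series of zeros and ones, so only finitely
many terms are 1. -/
theorem ae_finite_eventTime_le (a : C.State) (t : ℝ) :
    ∀ᵐ ω ∂C.prob, {n : ℕ | eventTime a ω n ≤ t}.Finite := by
  -- The horizon is `t + 1` because the reward counts events strictly before the horizon, while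
  -- events at time `t` must be included.
  filter_upwards [(isReward_eventReward (C := C) fun _ _ => 1).ae_summable_reward a (t + 1)]
    with ω hω
  have h := (tendsto_order.1 hω.tendsto_cofinite_zero).2 1 one_pos
  refine Set.Finite.subset (Filter.eventually_cofinite.1 h) fun n (hn : eventTime a ω n ≤ t) => ?_
  rw [eventTime_eq_startTime, startTime_succ] at hn
  have : (ω n (chain a ω n)).1 < t + 1 - startTime a ω n := by linarith
  simp [reward, eventReward, this]

/-- In this interval exactly the events with indices `0, …, n - 1` have happened. -/
theorem stateAt_eq_chain (a : C.State) {ω : C.Sample} (hω : ∀ n x, 0 < (ω n x).1) {n : ℕ} {u : ℝ}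
    (h1 : startTime a ω n ≤ u) (h2 : u < startTime a ω (n + 1)) :
    stateAt a ω u = chain a ω n := by
  have hm := strictMono_startTime a hω
  have h : {m : ℕ | eventTime a ω m ≤ u} = (Finset.range n : Set ℕ) := by
    ext m
    simp only [Set.mem_ofPred_eq, Finset.coe_range, Set.mem_Iio, eventTime_eq_startTime]
    constructor
    · intro hmu
      exact Nat.lt_of_succ_lt_succ (hm.lt_iff_lt.1 (hmu.trans_lt h2))
    · intro hmn
      exact (hm.monotone (Nat.succ_le_of_lt hmn)).trans h1
  rw [stateAt, h, Set.ncard_coe_finset, Finset.card_range]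

theorem exists_startTime_le_lt (a : C.State) {ω : C.Sample} {t u : ℝ}
    (hfin : {n : ℕ | eventTime a ω n ≤ t}.Finite) (h0 : 0 ≤ u) (hu : u < t) :
    ∃ n, startTime a ω n ≤ u ∧ u < startTime a ω (n + 1) := by
  classical
  have hex : ∃ n, u < startTime a ω n := by
    obtain ⟨n, hn⟩ := hfin.exists_notMem
    exact ⟨n + 1, hu.trans (not_le.1 hn)⟩
  -- The first start time beyond `u` is not the 0-th, which equals `0 ≤ u`; its predecessor is the
  -- required index.
  obtain ⟨n, hn⟩ : ∃ n, Nat.find hex = n + 1 := Nat.exists_eq_succ_of_ne_zero fun h => by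
    have := Nat.find_spec hex
    rw [h] at this
    exact absurd this (not_lt.2 (by simpa [startTime] using h0))
  exact ⟨n, not_lt.1 (Nat.find_min hex (by omega)), hn ▸ Nat.find_spec hex⟩

/-- The intervals between successive start times cover `[0, t)` disjointly, and the state is
constant on each. The part of the `n`-th one before `t` has length equal to the truncated holding
time. -/
theorem waitingTime_eq_tsum_reward (a : C.State) (t : ℝ)
    {ω : C.Sample} (hω : ∀ n x, 0 < (ω n x).1) (hfin : {n : ℕ | eventTime a ω n ≤ t}.Finite)
    (hs : Summable fun n => reward waitReward n a t ω) :
    waitingTime a t ω = ∑' n, reward waitReward n a t ω := by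
  set F : ℕ → ℝ → ℝ := fun n =>
    (Set.Ico (startTime a ω n) (startTime a ω (n + 1))).indicator
      fun _ => C.waiting (chain a ω n) with hF
  have hint : ∀ n, Integrable (F n) (volume.restrict (Set.Ico 0 t)) := fun n =>
    (integrable_const _).indicator measurableSet_Ico
  have hval : ∀ n, ∫ u in Set.Ico 0 t, F n u = reward waitReward n a t ω := by
    intro n
    rw [setIntegral_indicator measurableSet_Ico, setIntegral_const, Set.Ico_inter_Ico,
      max_eq_right (startTime_nonneg a hω n), Real.volume_real_Ico, reward, waitReward,
      startTime_succ, smul_eq_mul, mul_comm, max_comm, ← min_sub_sub_right, min_comm,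
      add_sub_cancel_left]
  have hF0 : ∀ n u, 0 ≤ F n u := fun n u => Set.indicator_nonneg (fun _ _ => waiting_nonneg _) u
  have hpt : ∀ u ∈ Set.Ico 0 t, C.waiting (stateAt a ω u) = ∑' n, F n u := by
    intro u hu
    obtain ⟨n, h1, h2⟩ := exists_startTime_le_lt a hfin hu.1 hu.2
    rw [stateAt_eq_chain a hω h1 h2, tsum_eq_single n]
    · rw [hF]
      simp only
      rw [Set.indicator_of_mem (Set.mem_Ico.2 ⟨h1, h2⟩)]
    · intro m hmn
      refine Set.indicator_of_notMem (fun hm => ?_) _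
      have hmono := (strictMono_startTime a hω)
      have h3 := hmono.lt_iff_lt.1 (h1.trans_lt hm.2)
      have h4 := hmono.lt_iff_lt.1 (hm.1.trans_lt h2)
      omega
  rw [waitingTime, ← integral_Ico_eq_integral_Ioo, setIntegral_congr_fun measurableSet_Ico hpt,
    ← integral_tsum_of_summable_integral_norm hint]
  · exact tsum_congr hval
  · refine hs.congr fun n => ?_
    rw [← hval]
    exact integral_congr_ae (Filter.Eventually.of_forall fun u => (Real.norm_of_nonneg (hF0 n u)).symm)

theorem eventSum_ae_eq (c : C.State → CallEvent → ℝ) (a : C.State) (t : ℝ) :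
    eventSum c a t =ᵐ[C.prob] fun ω => ∑' n, reward (eventReward c) n a t ω := by
  filter_upwards [ae_pos_prob C] with ω hω using eventSum_eq_tsum_reward c a t hω

theorem waitingTime_ae_eq (a : C.State) (t : ℝ) :
    waitingTime a t =ᵐ[C.prob] fun ω => ∑' n, reward waitReward n a t ω := by
  filter_upwards [ae_pos_prob C, ae_finite_eventTime_le a t,
    isReward_waitReward.ae_summable_reward a t] with ω hω hfin hs
    using waitingTime_eq_tsum_reward a t hω hfin hs

theorem A_eq_meanTotal (β γ : ℝ) :
    A (C := C) β γ = meanTotal (eventReward (eventCost β γ)) := by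
  ext a t
  exact integral_congr_ae (eventSum_ae_eq _ a t)

theorem S_eq_meanTotal : S (C := C) = meanTotal (eventReward serviceCount) := by
  ext a t
  exact integral_congr_ae (eventSum_ae_eq _ a t)

theorem W_eq_meanTotal : W (C := C) = meanTotal waitReward := by
  ext a t
  exact integral_congr_ae (waitingTime_ae_eq a t)

/-! ### Proportionality and the linear systems on the integers -/

theorem sum_callEvent {M : Type*} [AddCommMonoid M] (f : CallEvent → M) :
    ∑ e, f e = f .arrival + (f .service + f .abandonment) := by
  change ∑ e ∈ ({.arrival, .service, .abandonment} : Finset CallEvent), f e = _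
  rw [Finset.sum_insert (by decide), Finset.sum_insert (by decide), Finset.sum_singleton]

/-- With `β = 0` only abandonments cost, at rate `waiting * theta * γ`; both one-step means share
the factor `(1 - exp (-r t)) / r`. -/
theorem A_proportional (γ : ℝ) (a : C.State) (t : ℝ) :
    A 0 γ a t = C.theta * γ * W a t := by
  rw [A_eq_meanTotal, W_eq_meanTotal]
  refine meanTotal_proportional (isReward_eventReward _) isReward_waitReward (fun a t => ?_) a t
  rw [← meanReward_zero (isReward_eventReward _), ← meanReward_zero isReward_waitReward]
  rcases le_total 0 t with ht | ht
  · rw [meanReward_eventReward _ a ht, meanReward_waitReward a ht, sum_callEvent]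
    simp only [rate, eventCost, ite_self]
    ring
  · rw [meanReward_of_nonpos (isReward_eventReward _) 0 a ht,
      meanReward_of_nonpos isReward_waitReward 0 a ht, mul_zero]

theorem laplace_const_mul (c : ℝ) (f : ℝ → ℝ) (s : ℂ) :
    laplace (fun t => c * f t) s = c * laplace f s := by
  rw [laplace, laplace, ← integral_const_mul]
  congr 1
  ext t
  push_cast
  ring

theorem laplaceExt_coe (f : C.State → ℝ → ℝ) (x : C.State) (s : ℂ) :
    laplaceExt f ((x : ℕ) : ℤ) s = laplace (f x) s := by
  have := x.isLt
  rw [laplaceExt, dif_pos ⟨by omega, by omega⟩]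
  rfl

theorem laplaceExt_next_arrival (f : C.State → ℝ → ℝ) (x : C.State) (s : ℂ)
    (h : (x : ℕ) < C.ℓ) :
    laplaceExt f (((x : ℕ) : ℤ) + 1) s = laplace (f (C.next x .arrival)) s := by
  rw [← laplaceExt_coe, next, dif_pos h]
  push_cast
  rfl

theorem laplaceExt_pred (f : C.State → ℝ → ℝ) (x : C.State) (s : ℂ) (h : (x : ℕ) ≠ 0) :
    laplaceExt f (((x : ℕ) : ℤ) - 1) s = laplace (f (C.next x .service)) s := by
  rw [← laplaceExt_coe, next]
  congr 1
  simp only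
  omega

/-- The linear system, without blocked arrivals, that follows from the equations by events. -/
theorem laplaceExt_eq_div {f : C.State → ℝ → ℝ} {G : C.State → ℝ} {s : ℂ} (hs : 0 < s.re)
    (h : ∀ x, (C.totalRate x + s) * laplace (f x) s =
      (G x : ℂ) / s + ∑ e, (C.rate x e : ℂ) * laplace (f (C.next x e)) s) (x : C.State) :
    laplaceExt f ((x : ℕ) : ℤ) s =
      ((C.lam : ℂ) * laplaceExt f (((x : ℕ) : ℤ) + 1) s
            * (if ((x : ℕ) : ℤ) < (C.ℓ : ℤ) then 1 else 0)
          + ((C.busy x * C.mu + C.waiting x * C.theta : ℝ) : ℂ)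
            * laplaceExt f (((x : ℕ) : ℤ) - 1) s
          + (G x : ℂ) / s)
        / (((C.lam * (if ((x : ℕ) : ℤ) < (C.ℓ : ℤ) then 1 else 0)
              + C.busy x * C.mu + C.waiting x * C.theta : ℝ) : ℂ) + s) := by
  have hd0 : 0 ≤ C.busy x * C.mu := C.rate_nonneg x .service
  have hw0 : 0 ≤ C.waiting x * C.theta := C.rate_nonneg x .abandonment
  have hd : ((C.busy x * C.mu + C.waiting x * C.theta : ℝ) : ℂ) *
      laplaceExt f (((x : ℕ) : ℤ) - 1) s =
      ((C.busy x * C.mu + C.waiting x * C.theta : ℝ) : ℂ) *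
        laplace (f (C.next x .service)) s := by
    -- At 0 the two transforms may differ: `next` truncates `0 - 1` to 0, whereas `laplaceExt` is 0
    -- at `-1`. The departure rate vanishes there.
    by_cases hx : (x : ℕ) = 0
    · have : C.busy x * C.mu + C.waiting x * C.theta = 0 := by simp [busy, waiting, hx]
      simp [this]
    · rw [laplaceExt_pred f x s hx]
  have hden : (((C.lam * (if ((x : ℕ) : ℤ) < (C.ℓ : ℤ) then 1 else 0)
      + C.busy x * C.mu + C.waiting x * C.theta : ℝ) : ℂ) + s) ≠ 0 := fun h0 => by
    have := congrArg Complex.re h0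
    rw [Complex.add_re, Complex.ofReal_re, Complex.zero_re] at this
    have : 0 ≤ C.lam * (if ((x : ℕ) : ℤ) < (C.ℓ : ℤ) then (1 : ℝ) else 0) :=
      mul_nonneg C.lam_pos.le (by split_ifs <;> simp)
    linarith
  have hx := h x
  rw [totalRate, sum_callEvent, sum_callEvent] at hx
  have hab : C.next x .abandonment = C.next x .service := rfl
  rw [eq_div_iff hden, hd, laplaceExt_coe]
  simp only [rate, hab] at hx
  by_cases hl : (x : ℕ) < C.ℓ
  · have hl' : ((x : ℕ) : ℤ) < (C.ℓ : ℤ) := by exact_mod_cast hl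
    simp only [if_pos hl', laplaceExt_next_arrival f x s hl]
    push_cast at hx ⊢
    linear_combination hx
  · have hl' : ¬ ((x : ℕ) : ℤ) < (C.ℓ : ℤ) := by exact_mod_cast hl
    -- The blocked arrival returns to `x`, so its `lam` term occurs on both sides of `hx` and
    -- cancels; hence `lam` is absent from the denominator at `ℓ`.
    have hn : C.next x .arrival = x := by rw [next, dif_neg hl]
    simp only [if_neg hl']
    rw [hn] at hx
    push_cast at hx ⊢
    linear_combination hx

end CallCentre

end

theorem mainTheorem1 (C : CallCentre) (β γ : ℝ) :
    -- on almost every path only finitely many events happen in bounded time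
    (∀ a : C.State, ∀ t : ℝ, ∀ᵐ ω ∂C.prob, {n : ℕ | CallCentre.eventTime a ω n ≤ t}.Finite) ∧
    -- the three expectations exist
    (∀ a : C.State, ∀ t : ℝ, 0 < t →
      Integrable (CallCentre.cost β γ a t) C.prob ∧
      Integrable (CallCentre.waitingTime a t) C.prob ∧
      Integrable (CallCentre.services a t) C.prob) ∧
    -- the three Laplace transforms exist
    (∀ a : C.State, ∀ s : ℂ, 0 < s.re →
      CallCentre.LaplaceConverges (CallCentre.A β γ a) s ∧
      CallCentre.LaplaceConverges (CallCentre.W a) s ∧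
      CallCentre.LaplaceConverges (CallCentre.S a) s) ∧
    -- the three linear systems
    (∀ a : ℤ, 0 ≤ a → a ≤ (C.ℓ : ℤ) → ∀ s : ℂ, 0 < s.re →
      CallCentre.laplaceExt (C := C) (CallCentre.A β γ) a s =
        ((C.lam : ℂ) * CallCentre.laplaceExt (C := C) (CallCentre.A β γ) (a + 1) s
              * (if a < (C.ℓ : ℤ) then 1 else 0)
            + ((min (a : ℝ) (C.k : ℝ) * C.mu + max 0 ((a : ℝ) - (C.k : ℝ)) * C.theta : ℝ) : ℂ)
              * CallCentre.laplaceExt (C := C) (CallCentre.A β γ) (a - 1) s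
            + ((max 0 ((a : ℝ) - (C.k : ℝ)) * C.theta * γ
                + C.lam * β * (if a = (C.ℓ : ℤ) then 1 else 0) : ℝ) : ℂ) / s)
          / (((C.lam * (if a < (C.ℓ : ℤ) then 1 else 0)
                + min (a : ℝ) (C.k : ℝ) * C.mu
                + max 0 ((a : ℝ) - (C.k : ℝ)) * C.theta : ℝ) : ℂ) + s) ∧
      CallCentre.laplaceExt (C := C) CallCentre.W a s =
        ((C.lam : ℂ) * CallCentre.laplaceExt (C := C) CallCentre.W (a + 1) s
              * (if a < (C.ℓ : ℤ) then 1 else 0)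
            + ((min (a : ℝ) (C.k : ℝ) * C.mu + max 0 ((a : ℝ) - (C.k : ℝ)) * C.theta : ℝ) : ℂ)
              * CallCentre.laplaceExt (C := C) CallCentre.W (a - 1) s
            + ((max 0 ((a : ℝ) - (C.k : ℝ)) : ℝ) : ℂ) / s)
          / (((C.lam * (if a < (C.ℓ : ℤ) then 1 else 0)
                + min (a : ℝ) (C.k : ℝ) * C.mu
                + max 0 ((a : ℝ) - (C.k : ℝ)) * C.theta : ℝ) : ℂ) + s) ∧
      CallCentre.laplaceExt (C := C) CallCentre.S a s =
        ((C.lam : ℂ) * CallCentre.laplaceExt (C := C) CallCentre.S (a + 1) s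
              * (if a < (C.ℓ : ℤ) then 1 else 0)
            + ((min (a : ℝ) (C.k : ℝ) * C.mu + max 0 ((a : ℝ) - (C.k : ℝ)) * C.theta : ℝ) : ℂ)
              * CallCentre.laplaceExt (C := C) CallCentre.S (a - 1) s
            + ((min (a : ℝ) (C.k : ℝ) * C.mu : ℝ) : ℂ) / s)
          / (((C.lam * (if a < (C.ℓ : ℤ) then 1 else 0)
                + min (a : ℝ) (C.k : ℝ) * C.mu
                + max 0 ((a : ℝ) - (C.k : ℝ)) * C.theta : ℝ) : ℂ) + s)) ∧
    -- without blocking cost, abandonment cost and waiting time are proportional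
    (β = 0 →
      (∀ a : C.State, ∀ t : ℝ, 0 < t →
        CallCentre.A β γ a t = C.theta * γ * CallCentre.W a t) ∧
      (∀ a : ℤ, ∀ s : ℂ, 0 < s.re →
        CallCentre.laplaceExt (C := C) (CallCentre.A β γ) a s =
          (C.theta : ℂ) * (γ : ℂ) * CallCentre.laplaceExt (C := C) CallCentre.W a s)) := by
  refine ⟨fun a t => CallCentre.ae_finite_eventTime_le a t, fun a t _ => ⟨?_, ?_, ?_⟩,
    fun a s hs => ?_, ?_, ?_⟩
  · exact ((CallCentre.isReward_eventReward _).integrable_tsum_reward a t).congr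
      (CallCentre.eventSum_ae_eq _ a t).symm
  · exact (CallCentre.isReward_waitReward.integrable_tsum_reward a t).congr
      (CallCentre.waitingTime_ae_eq a t).symm
  · exact ((CallCentre.isReward_eventReward _).integrable_tsum_reward a t).congr
      (CallCentre.eventSum_ae_eq _ a t).symm
  · rw [CallCentre.A_eq_meanTotal, CallCentre.W_eq_meanTotal, CallCentre.S_eq_meanTotal]
    exact ⟨(CallCentre.isReward_eventReward _).laplaceConverges_meanTotal a hs,
      CallCentre.isReward_waitReward.laplaceConverges_meanTotal a hs,
      (CallCentre.isReward_eventReward _).laplaceConverges_meanTotal a hs⟩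
  · intro a h0 hl s hs
    obtain ⟨x, rfl⟩ : ∃ x : C.State, a = ((x : ℕ) : ℤ) := ⟨⟨a.toNat, by omega⟩, by simp [h0]⟩
    rw [CallCentre.A_eq_meanTotal, CallCentre.W_eq_meanTotal, CallCentre.S_eq_meanTotal]
    refine ⟨?_, ?_, ?_⟩
    · refine (CallCentre.laplaceExt_eq_div hs
        (fun x => CallCentre.laplace_meanTotal_eventReward _ x hs) x).trans ?_
      rw [CallCentre.sum_callEvent]
      simp only [CallCentre.rate, CallCentre.eventCost, CallCentre.busy, CallCentre.waiting,
        Int.cast_natCast, Nat.cast_inj]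
      congr 3
      split_ifs <;> push_cast <;> ring
    · refine (CallCentre.laplaceExt_eq_div hs
        (fun x => CallCentre.laplace_meanTotal_waitReward x hs) x).trans ?_
      simp only [CallCentre.busy, CallCentre.waiting, Int.cast_natCast]
    · refine (CallCentre.laplaceExt_eq_div hs
        (fun x => CallCentre.laplace_meanTotal_eventReward _ x hs) x).trans ?_
      rw [CallCentre.sum_callEvent]
      simp only [CallCentre.rate, CallCentre.serviceCount, CallCentre.busy, CallCentre.waiting,
        Int.cast_natCast, mul_zero, mul_one, zero_add, add_zero]
  · rintro rfl
    refine ⟨fun a t _ => CallCentre.A_proportional γ a t, fun a s _ => ?_⟩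
    unfold CallCentre.laplaceExt
    split_ifs
    · rw [show CallCentre.A 0 γ _ = _ from funext fun t => CallCentre.A_proportional γ _ t,
        CallCentre.laplace_const_mul, Complex.ofReal_mul]
    · rw [mul_zero]
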